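/- Let $a\in(1,2)$, $\beta\in[0,1)$, and let $n:\mathbb R\to\mathbb R$ be a real analytic function, not identically zero, with $n(0)=n'(0)=0$. Let $\mathbb T=\mathbb R/2\pi\mathbb Z$ and $\hat f(k)=\frac1{2\pi}\int_{\mathbb T}f(x)e^{-ikx}\,dx$. Let $C^a_{0,\mathrm{even}}(\mathbb T)$ be the space of real-valued, even, $2\pi$-periodic functions $f$ of zero mean that are continuously differentiable with $(a-1)$-Hölder continuous derivative, normed by $$\|f\|=\sup_x|f(x)|+\sup_x|f'(x)|+\sup_{x\ne y}\frac{|f'(x)-f'(y)|}{|x-y|^{a-1}}.$$ Let $D^{-2}$ (on functions of zero mean) and, for $c>0$, $L_{\beta,c}=(c+\beta D^2)^{-1}$ be the Fourier multiplier operators on $\mathbb T$ with symbols $k^{-2}$ ($k\ne0$) and $(c+\beta k^2)^{-1}$, respectively. Consider, for $c>0$ and $\phi\in C^a_{0,\mathrm{even}}(\mathbb T)$, the equation $$-\phi+D^{-2}L_{\beta,c}\phi+L_{\beta,c}n(\phi)=B_\phi,\qquad B_\phi=\frac1c\cdot\frac1{2\pi}\int_{\mathbb T}n(\phi(x))\,dx,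 \tag{1}$$ which has the trivial solutions $(c,0)$, $c>0$. Put $c_*=1-\beta$. Theorem (Local bifurcation). A local analytic curve of nontrivial solutions of (1) bifurcates from the trivial solutions at $(c_*,0)$: there are $\varepsilon_0>0$ and a curve $$\{(c(\varepsilon),\phi(\varepsilon)) : |\varepsilon|<\varepsilon_0\}\subset\mathbb R_+\times C^a_{0,\mathrm{even}}(\mathbb T),$$ with $c:(-\varepsilon_0,\varepsilon_0)\to\mathbb R_+=(0,\infty)$ and $\phi:(-\varepsilon_0,\varepsilon_0)\to C^a_{0,\mathrm{even}}(\mathbb T)$ real analytic, such that $c(0)=c_*$, $\phi(0)=0$, $\phi'(0)=\cos$ (derivative in $C^a_{0,\mathrm{even}}(\mathbb T)$), $(c(\varepsilon),\phi(\varepsilon))$ solves (1) for every $|\varepsilon|<\varepsilon_0$, and $\phi(\varepsilon)\neq0$ for $0<|\varepsilon|<\varepsilon_0$. -/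

import Mathlib

/-! ### Periodic Hölder spaces -/

/-- The real vector space `C^a(𝕋) = C^{1, a-1}(𝕋)`, `1 < a < 2`: `2π`-periodic, continuously
differentiable functions whose derivative is Hölder continuous with exponent `a - 1`. Functions
on `𝕋 = ℝ / 2πℤ` are identified with `2π`-periodic functions on `ℝ`. -/
def periodicHolder (a : ℝ) : Submodule ℝ (ℝ → ℝ) where
  carrier := {f | Function.Periodic f (2 * Real.pi) ∧ ContDiff ℝ 1 f ∧
    ∃ C : ℝ, ∀ x y : ℝ, |deriv f x - deriv f y| ≤ C * |x - y| ^ (a - 1)}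
  zero_mem' := by
    refine ⟨fun x => rfl, contDiff_const, 0, fun x y => ?_⟩
    simp [show (0 : ℝ → ℝ) = fun _ => (0 : ℝ) from rfl]
  add_mem' := by
    rintro f g ⟨hf, hf1, C, hC⟩ ⟨hg, hg1, C', hC'⟩
    refine ⟨hf.add hg, hf1.add hg1, C + C', fun x y => ?_⟩
    have e : ∀ z, deriv (f + g) z = deriv f z + deriv g z := fun z =>
      deriv_add (hf1.differentiable one_ne_zero z) (hg1.differentiable one_ne_zero z)
    rw [e, e, add_mul]
    calc |deriv f x + deriv g x - (deriv f y + deriv g y)|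
        = |(deriv f x - deriv f y) + (deriv g x - deriv g y)| := by ring_nf
      _ ≤ _ := (abs_add_le _ _).trans (add_le_add (hC x y) (hC' x y))
  smul_mem' := by
    rintro r f ⟨hf, hf1, C, hC⟩
    refine ⟨fun x => by simp [hf x], hf1.const_smul r, |r| * C, fun x y => ?_⟩
    have e : ∀ z, deriv (r • f) z = r * deriv f z := fun z => by
      simpa using deriv_const_smul r (hf1.differentiable one_ne_zero z)
    rw [e, e, ← mul_sub, abs_mul, mul_assoc]
    exact mul_le_mul_of_nonneg_left (hC x y) (abs_nonneg r)

/-- The norm of `C^{1, a-1}(𝕋)`: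
`sup |f| + sup |f'| + sup_{x ≠ y} |f'(x) - f'(y)| / |x - y|^{a-1}`
(the quotient is `0` for `x = y`). -/
noncomputable def holderNorm (a : ℝ) (f : ℝ → ℝ) : ℝ :=
  (⨆ x : ℝ, |f x|) + (⨆ x : ℝ, |deriv f x|) +
    ⨆ p : ℝ × ℝ, |deriv f p.1 - deriv f p.2| / |p.1 - p.2| ^ (a - 1)

/-- The subspace of even functions of zero mean in `C^a(𝕋)`. -/
def periodicHolderZeroEven (a : ℝ) : Submodule ℝ (ℝ → ℝ) where
  carrier := {f | f ∈ periodicHolder a ∧ (∀ x, f (-x) = f x) ∧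
    ∫ x in (0 : ℝ)..(2 * Real.pi), f x = 0}
  zero_mem' := ⟨zero_mem _, fun _ => rfl, by simp⟩
  add_mem' := by
    rintro f g ⟨hf, hfe, hfm⟩ ⟨hg, hge, hgm⟩
    refine ⟨add_mem hf hg, fun x => by simp [hfe, hge], ?_⟩
    simp only [Pi.add_apply]
    rw [intervalIntegral.integral_add (hf.2.1.continuous.intervalIntegrable _ _)
      (hg.2.1.continuous.intervalIntegrable _ _), hfm, hgm, add_zero]
  smul_mem' := by
    rintro r f ⟨hf, hfe, hfm⟩
    refine ⟨Submodule.smul_mem _ r hf, fun x => by simp [hfe], ?_⟩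
    simp [hfm]

/-- The space `C^a_{0,even}(𝕋)`, to be normed by `holderNorm a`. -/
def HolderZeroEven (a : ℝ) : Type := ↥(periodicHolderZeroEven a)

namespace HolderZeroEven

variable {a : ℝ}

noncomputable instance : AddCommGroup (HolderZeroEven a) :=
  inferInstanceAs (AddCommGroup ↥(periodicHolderZeroEven a))

noncomputable instance : Module ℝ (HolderZeroEven a) :=
  inferInstanceAs (Module ℝ ↥(periodicHolderZeroEven a))

instance : CoeFun (HolderZeroEven a) (fun _ => ℝ → ℝ) := ⟨fun f => f.1⟩

theorem coe_add (f g : HolderZeroEven a) (x : ℝ) : (f + g) x = f x + g x := rfl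

theorem coe_smul (r : ℝ) (f : HolderZeroEven a) (x : ℝ) : (r • f) x = r * f x := rfl

theorem contDiff (f : HolderZeroEven a) : ContDiff ℝ 1 f := f.2.1.2.1

theorem deriv_add' (f g : HolderZeroEven a) (x : ℝ) :
    deriv (f + g : HolderZeroEven a) x = deriv f x + deriv g x :=
  deriv_add (f.contDiff.differentiable one_ne_zero x) (g.contDiff.differentiable one_ne_zero x)

theorem deriv_smul' (r : ℝ) (f : HolderZeroEven a) (x : ℝ) :
    deriv (r • f : HolderZeroEven a) x = r * deriv f x := by
  exact deriv_const_smul r (f.contDiff.differentiable one_ne_zero x)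

theorem bddAbove_of_periodic {g : ℝ → ℝ} (hg : Function.Periodic g (2 * Real.pi))
    (hc : Continuous g) : BddAbove (Set.range fun x => |g x|) := by
  obtain ⟨C, hC⟩ := (isCompact_Icc (a := (0 : ℝ)) (b := 0 + 2 * Real.pi)).exists_bound_of_continuousOn
    hc.continuousOn
  refine ⟨C, ?_⟩
  rintro _ ⟨x, rfl⟩
  obtain ⟨y, hy, hxy⟩ := hg.exists_mem_Ico₀ Real.two_pi_pos x
  change |g x| ≤ C
  rw [hxy]
  exact hC y ⟨hy.1, by simpa using hy.2.le⟩

theorem bdd_fun (f : HolderZeroEven a) : BddAbove (Set.range fun x => |f x|) :=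
  bddAbove_of_periodic f.2.1.1 f.contDiff.continuous

theorem bdd_deriv (f : HolderZeroEven a) : BddAbove (Set.range fun x => |deriv f x|) := by
  refine bddAbove_of_periodic (fun x => ?_) (f.contDiff.continuous_deriv le_rfl)
  have h : (fun y => f (y + 2 * Real.pi)) = (f : ℝ → ℝ) := funext f.2.1.1
  rw [← deriv_comp_add_const, h]

theorem bdd_quot (f : HolderZeroEven a) : BddAbove (Set.range fun p : ℝ × ℝ =>
    |deriv f p.1 - deriv f p.2| / |p.1 - p.2| ^ (a - 1)) := by
  obtain ⟨C, hC⟩ := f.2.1.2.2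
  refine ⟨max C 0, ?_⟩
  rintro _ ⟨⟨x, y⟩, rfl⟩
  rcases eq_or_ne x y with rfl | h
  · simp
  · refine le_max_of_le_left ?_
    rw [div_le_iff₀ (Real.rpow_pos_of_pos (abs_pos.2 (sub_ne_zero.2 h)) _)]
    exact hC x y

noncomputable instance : Norm (HolderZeroEven a) := ⟨fun f => holderNorm a f⟩

theorem norm_def (f : HolderZeroEven a) : ‖f‖ = holderNorm a f := rfl

theorem normCore : NormedSpace.Core ℝ (HolderZeroEven a) where
  norm_nonneg f := by
    refine add_nonneg (add_nonneg ?_ ?_) ?_ <;> refine Real.iSup_nonneg fun _ => ?_ <;> positivity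
  norm_smul r f := by
    simp only [norm_def, holderNorm, deriv_smul', coe_smul, ← mul_sub, abs_mul, mul_div_assoc,
      Real.norm_eq_abs, ← Real.mul_iSup_of_nonneg (abs_nonneg r), mul_add]
  norm_triangle f g := by
    simp only [norm_def, holderNorm]
    have h1 : (⨆ x : ℝ, |(f + g : HolderZeroEven a) x|) ≤ (⨆ x : ℝ, |f x|) + ⨆ x : ℝ, |g x| :=
      ciSup_le fun x => (abs_add_le _ _).trans
        (add_le_add (le_ciSup f.bdd_fun x) (le_ciSup g.bdd_fun x))
    have h2 : (⨆ x : ℝ, |deriv (f + g : HolderZeroEven a) x|) ≤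
        (⨆ x : ℝ, |deriv f x|) + ⨆ x : ℝ, |deriv g x| :=
      ciSup_le fun x => by
        rw [deriv_add']
        exact (abs_add_le _ _).trans
          (add_le_add (le_ciSup f.bdd_deriv x) (le_ciSup g.bdd_deriv x))
    have h3 : (⨆ p : ℝ × ℝ, |deriv (f + g : HolderZeroEven a) p.1 -
          deriv (f + g : HolderZeroEven a) p.2| / |p.1 - p.2| ^ (a - 1)) ≤
        (⨆ p : ℝ × ℝ, |deriv f p.1 - deriv f p.2| / |p.1 - p.2| ^ (a - 1)) +
        ⨆ p : ℝ × ℝ, |deriv g p.1 - deriv g p.2| / |p.1 - p.2| ^ (a - 1) :=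
      ciSup_le fun p => by
        refine le_trans ?_ (add_le_add (le_ciSup f.bdd_quot p) (le_ciSup g.bdd_quot p))
        rw [deriv_add', deriv_add', ← add_div]
        refine div_le_div_of_nonneg_right ?_ (by positivity)
        rw [add_sub_add_comm]
        exact abs_add_le _ _
    linarith
  norm_eq_zero_iff f := by
    constructor
    · intro h
      have n1 : 0 ≤ ⨆ x : ℝ, |f x| := Real.iSup_nonneg fun _ => abs_nonneg _
      have n2 : 0 ≤ ⨆ x : ℝ, |deriv f x| := Real.iSup_nonneg fun _ => abs_nonneg _
      have n3 : 0 ≤ ⨆ p : ℝ × ℝ, |deriv f p.1 - deriv f p.2| / |p.1 - p.2| ^ (a - 1) :=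
        Real.iSup_nonneg fun _ => by positivity
      simp only [norm_def, holderNorm] at h
      have h0 : (⨆ x : ℝ, |f x|) = 0 := by linarith
      refine Subtype.ext (funext fun x => ?_)
      have hx := le_ciSup f.bdd_fun x
      exact abs_eq_zero.1 (le_antisymm (hx.trans h0.le) (abs_nonneg _))
    · rintro rfl
      have e : ((0 : HolderZeroEven a) : ℝ → ℝ) = fun _ => (0 : ℝ) := rfl
      simp [norm_def, holderNorm, e]

noncomputable instance : NormedAddCommGroup (HolderZeroEven a) :=
  NormedAddCommGroup.ofCore normCore

noncomputable instance : NormedSpace ℝ (HolderZeroEven a) :=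
  NormedSpace.ofCore normCore

theorem cos_mem (a : ℝ) (h1 : 1 < a) (h2 : a < 2) : Real.cos ∈ periodicHolderZeroEven a := by
  refine ⟨⟨Real.cos_periodic, Real.contDiff_cos, 2, fun x y => ?_⟩, Real.cos_neg, by simp⟩
  simp only [Real.deriv_cos]
  have hs : |-Real.sin x - -Real.sin y| ≤ |x - y| := by
    have := Real.abs_sin_sub_sin_le x y
    rw [show -Real.sin x - -Real.sin y = -(Real.sin x - Real.sin y) by ring, abs_neg]
    exact this
  have hb : |-Real.sin x - -Real.sin y| ≤ 2 := by
    have := Real.sin_le_one x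
    have := Real.neg_one_le_sin x
    have := Real.sin_le_one y
    have := Real.neg_one_le_sin y
    rw [abs_le]; constructor <;> linarith
  rcases le_or_gt |x - y| 1 with h | h
  · have : |x - y| ≤ |x - y| ^ (a - 1) := by
      simpa using Real.rpow_le_rpow_of_exponent_ge_of_imp (abs_nonneg (x - y)) h
        (show a - 1 ≤ 1 by linarith) (fun _ => by intro h; linarith)
    have h0 : 0 ≤ |x - y| ^ (a - 1) := by positivity
    linarith
  · have : 1 ≤ |x - y| ^ (a - 1) := Real.one_le_rpow h.le (by linarith)
    linarith

end HolderZeroEven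

/-! ### Fourier multipliers and the steady equation -/

/-- The Fourier coefficients `f̂(k)` of a function on `𝕋` are `fourierCoeffOn Real.two_pi_pos f k`,
that is `(1/2π) ∫_𝕋 f(x) e^{-ikx} dx`. -/
theorem torus_fourierCoeff_eq (f : ℝ → ℂ) (k : ℤ) :
    fourierCoeffOn Real.two_pi_pos f k = (1 / (2 * Real.pi : ℂ)) *
      ∫ x in (0 : ℝ)..(2 * Real.pi), Complex.exp (-(Complex.I * k * x)) * f x := by
  rw [fourierCoeffOn_eq_integral]
  simp only [smul_eq_mul, Complex.real_smul, sub_zero]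
  push_cast
  congr 1
  refine intervalIntegral.integral_congr fun x _ => ?_
  simp only [fourier_coe_apply]
  congr 2
  have : (Real.pi : ℂ) ≠ 0 := by exact_mod_cast Real.pi_ne_zero
  push_cast
  field_simp
  ring_nf

/-- The Fourier multiplier operator with symbol `m`: `(m f)(x) = ∑ₖ m(k) f̂(k) e^{ikx}`.
For a bounded symbol and `f` of class `C^1` (the only case used) the series converges
absolutely. -/
noncomputable def fourierMultiplier (m : ℤ → ℂ) (f : ℝ → ℂ) (x : ℝ) : ℂ :=
  ∑' k : ℤ, m k * fourierCoeffOn Real.two_pi_pos f k * Complex.exp (Complex.I * k * x)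

/-- `D^{-2}`, `D = i∂ₓ`, with symbol `k^{-2}` for `k ≠ 0`. It is only applied to functions of zero
mean, for which the value of the symbol at `k = 0` plays no role. -/
noncomputable def invDSq (f : ℝ → ℂ) : ℝ → ℂ :=
  fourierMultiplier (fun k => if k = 0 then 0 else 1 / (k : ℂ) ^ 2) f

/-- `L_{β,c} = (c + β D²)^{-1}`, with symbol `1 / (c + β k²)`. -/
noncomputable def opL (β c : ℝ) (f : ℝ → ℂ) : ℝ → ℂ :=
  fourierMultiplier (fun k => 1 / ((c : ℂ) + (β : ℂ) * (k : ℂ) ^ 2)) f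

/-- The integration constant `B_φ`: `1 / c` times the mean of `n(φ)` over one period. -/
noncomputable def constB (n : ℝ → ℝ) (c : ℝ) (φ : ℝ → ℝ) : ℝ :=
  (1 / c) * ((1 / (2 * Real.pi)) * ∫ x in (0 : ℝ)..(2 * Real.pi), n (φ x))

/-- `φ` solves the nonlocal steady equation
`-φ + D^{-2} L_{β,c} φ + L_{β,c} n(φ) = B_φ` with wave speed `c`. -/
def IsSteadySolution (β : ℝ) (n : ℝ → ℝ) (c : ℝ) (φ : ℝ → ℝ) : Prop :=
  ∀ x : ℝ, -(φ x : ℂ) + invDSq (opL β c (fun y => (φ y : ℂ))) x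
    + opL β c (fun y => (n (φ y) : ℂ)) x = (constB n c φ : ℂ)

/-!
The bifurcation is carried out in a small Banach algebra `CosAlgebra` of cosine series
`∑ u_k cos(kx) / (1 + k)²` with `∑ |u_k| < ∞`, which embeds continuously in the Hölder space
(`CosAlgebra.toHolder`). There Fourier multipliers with bounded even symbols are diagonal
(`CosAlgebra.fourierMultiplier_ev`), and an analytic `n` with `n(0) = n'(0) = 0` acts near `0` by
`u ↦ u² M(u)`, with `M` the power series of `n(t) / t²` evaluated in the algebra
(`CosAlgebra.exists_analyticAt_quadratic_factor`).

Apart from the mean, which the constant `B_φ` takes care of, the equation reads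
`(c + βk² - k⁻²) û(k) = (n(u))^(k)` for all `k ≥ 1` (`CosAlgebra.isSteadySolution_ev`). At
`c = 1 - β` the symbol `1 - β + βk² - k⁻²` vanishes for `k = 1` and is at least `3/4` for `k ≥ 2`.
Write `u = ε (cos + ψ)` with `ψ` supported on the modes `k ≥ 2`, and `c = 1 - β + μ`. After division
by `ε` the nonlinear term becomes `ε (cos + ψ)² M(ε (cos + ψ))`, so the mode `k = 1` determines `μ`
and the modes `k ≥ 2` determine `ψ`: inverting the symbol turns the system into a fixed point
problem `v = G(ε, v)` for `v = (μ, ψ)`, with `G` analytic, `G(0, 0) = 0` and `∂_v G(0, 0) = 0`. The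
analytic implicit function theorem (`exists_analyticAt_fixedPoint`) gives the curve `v(ε)`, and
`φ(ε) = ε (cos + ψ(ε))` has first mode `ε`, hence is nontrivial for `ε ≠ 0`.
-/

open scoped Topology ContDiff

/-! ### An analytic fixed point theorem -/

/-- The analytic implicit function theorem for `v = G(ε, v)` when `∂_v G` vanishes at the origin. -/
theorem exists_analyticAt_fixedPoint {E : Type*} [NormedAddCommGroup E] [NormedSpace ℝ E]
    [CompleteSpace E] {G : ℝ × E → E} (hG : AnalyticAt ℝ G 0) (hG0 : G 0 = 0)
    (hG' : HasFDerivAt (fun v => G (0, v)) (0 : E →L[ℝ] E) 0) :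
    ∃ v : ℝ → E, AnalyticAt ℝ v 0 ∧ v 0 = 0 ∧ ∀ᶠ ε in 𝓝 (0 : ℝ), v ε = G (ε, v ε) := by
  set F : ℝ × E → E := fun p => p.2 - G p with hF
  have hFc : ContDiffAt ℝ ω F (0, 0) := (analyticAt_snd.sub hG).contDiffAt
  have hω : (ω : WithTop ℕ∞) ≠ 0 := by simp
  have hd : fderiv ℝ F (0, 0) ∘L .inr ℝ ℝ E = .id ℝ E := by
    have h1 : HasFDerivAt (fun v : E => F (0, v)) (fderiv ℝ F (0, 0) ∘L .inr ℝ ℝ E) 0 :=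
      HasFDerivAt.comp (0 : E) (hFc.differentiableAt hω).hasFDerivAt (hasFDerivAt_prodMk_right 0 0)
    have h2 : HasFDerivAt (fun v : E => F (0, v)) (.id ℝ E - 0) 0 := (hasFDerivAt_id 0).sub hG'
    rw [h1.unique h2, sub_zero]
  have hinv : (fderiv ℝ F (0, 0) ∘L .inr ℝ ℝ E).IsInvertible :=
    ⟨ContinuousLinearEquiv.refl ℝ E, hd.symm⟩
  refine ⟨hFc.implicitFunction hω hinv, (hFc.contDiffAt_implicitFunction hω hinv).analyticAt,
    hFc.implicitFunction_apply_self hω hinv, ?_⟩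
  filter_upwards [hFc.eventually_apply_implicitFunction hω hinv] with ε hε
  have h0 : F (0, 0) = 0 := by simp only [hF]; exact sub_eq_zero.2 hG0.symm
  exact sub_eq_zero.1 (hε.trans h0)

/-! ### Absolutely summable cosine series -/

/-- The Banach space `ℓ¹(ℕ, ℝ)`, whose element `u` stands for the even `2π`-periodic function
`x ↦ ∑ u_k cos(kx) / (1 + k)²`; see `CosAlgebra.ev`. The weight is absorbed in the coordinates, so
that the norm is the plain `ℓ¹` norm. -/
def CosAlgebra : Type := lp (fun _ : ℕ => ℝ) 1

namespace CosAlgebra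

noncomputable instance instNormedAddCommGroup : NormedAddCommGroup CosAlgebra :=
  inferInstanceAs (NormedAddCommGroup (lp (fun _ : ℕ => ℝ) 1))

noncomputable instance : NormedSpace ℝ CosAlgebra :=
  inferInstanceAs (NormedSpace ℝ (lp (fun _ : ℕ => ℝ) 1))

instance : CompleteSpace CosAlgebra :=
  inferInstanceAs (CompleteSpace (lp (fun _ : ℕ => ℝ) 1))

/-- The coordinate `u ↦ u_k`. -/
noncomputable def coord (k : ℕ) : CosAlgebra →L[ℝ] ℝ :=
  lp.evalCLM ℝ (fun _ : ℕ => ℝ) 1 k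

/-- The unit vector `e_k`, which stands for `cos(kx) / (1 + k)²`. -/
noncomputable def basisVec (k : ℕ) : CosAlgebra :=
  lp.single (E := fun _ : ℕ => ℝ) 1 k (1 : ℝ)

theorem norm_basisVec (k : ℕ) : ‖basisVec k‖ = 1 :=
  (lp.norm_single (E := fun _ : ℕ => ℝ) zero_lt_one k (1 : ℝ)).trans norm_one

theorem coord_basisVec (j k : ℕ) : coord j (basisVec k) = if j = k then 1 else 0 := by
  change Pi.single (M := fun _ : ℕ => ℝ) k (1 : ℝ) j = _
  rw [Pi.single_apply]

theorem ext_coord {u v : CosAlgebra} (h : ∀ k, coord k u = coord k v) : u = v :=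
  lp.ext (funext h)

theorem hasSum_abs_coord (u : CosAlgebra) : HasSum (fun k => |coord k u|) ‖u‖ := by
  simpa using! lp.hasSum_norm (p := 1) (by simp) u

theorem hasSum_basisVec (u : CosAlgebra) : HasSum (fun k => coord k u • basisVec k) u := by
  have h := lp.hasSum_single (E := fun _ : ℕ => ℝ) (p := 1) (by simp) u
  refine (congrArg (HasSum · u) (funext fun k => ?_)).mpr h
  refine (lp.single_smul (E := fun _ : ℕ => ℝ) (𝕜 := ℝ) 1 k (coord k u) (1 : ℝ)).symm.trans ?_
  rw [smul_eq_mul, mul_one]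
  rfl

/-! ### Bounded operators on `ℓ¹` given by their values on unit vectors -/

section sumCLM

variable {F : Type*} [NormedAddCommGroup F] [NormedSpace ℝ F]

theorem clm_ext {f g : CosAlgebra →L[ℝ] F} (h : ∀ k, f (basisVec k) = g (basisVec k)) :
    f = g := by
  ext u
  have hf := f.hasSum (hasSum_basisVec u)
  have hg := g.hasSum (hasSum_basisVec u)
  simp only [map_smul, h] at hf hg
  exact hf.unique hg

theorem summable_norm_coord_smul {C : ℝ} {v : ℕ → F} (hv : ∀ k, ‖v k‖ ≤ C) (u : CosAlgebra) :
    Summable fun k => ‖coord k u • v k‖ := by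
  refine Summable.of_nonneg_of_le (fun _ => norm_nonneg _) (fun k => ?_)
    ((hasSum_abs_coord u).summable.mul_right C)
  rw [norm_smul, Real.norm_eq_abs]
  exact mul_le_mul_of_nonneg_left (hv k) (abs_nonneg _)

theorem norm_tsum_coord_smul_le {C : ℝ} {v : ℕ → F} (hv : ∀ k, ‖v k‖ ≤ C) (u : CosAlgebra) :
    ‖∑' k, coord k u • v k‖ ≤ C * ‖u‖ := by
  refine tsum_of_norm_bounded (f := fun k => coord k u • v k)
    (g := fun k => C * |coord k u|) ((hasSum_abs_coord u).mul_left C) fun k => ?_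
  rw [norm_smul, Real.norm_eq_abs, mul_comm]
  exact mul_le_mul_of_nonneg_right (hv k) (abs_nonneg _)

variable [CompleteSpace F]

/-- The bounded operator `u ↦ ∑ u_k v_k` that sends `e_k` to `v_k`, for a sequence `v` bounded
by `C`. -/
noncomputable def sumCLM (C : ℝ) (v : ℕ → F) (hv : ∀ k, ‖v k‖ ≤ C) : CosAlgebra →L[ℝ] F :=
  LinearMap.mkContinuous
    { toFun := fun u => ∑' k, coord k u • v k
      map_add' := fun u u' => by
        rw [← (summable_norm_coord_smul hv u).of_norm.tsum_add
          (summable_norm_coord_smul hv u').of_norm]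
        simp only [map_add, add_smul]
      map_smul' := fun r u => by
        rw [RingHom.id_apply, ← (summable_norm_coord_smul hv u).of_norm.tsum_const_smul]
        simp only [map_smul, smul_eq_mul, mul_smul] }
    C (norm_tsum_coord_smul_le hv)

theorem sumCLM_apply {C : ℝ} {v : ℕ → F} (hv : ∀ k, ‖v k‖ ≤ C) (u : CosAlgebra) :
    sumCLM C v hv u = ∑' k, coord k u • v k := rfl

theorem sumCLM_basisVec {C : ℝ} {v : ℕ → F} (hv : ∀ k, ‖v k‖ ≤ C) (k : ℕ) :
    sumCLM C v hv (basisVec k) = v k := by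
  rw [sumCLM_apply, tsum_eq_single k]
  · simp [coord_basisVec]
  · intro j hj
    simp [coord_basisVec, hj]

theorem norm_sumCLM_le {C : ℝ} {v : ℕ → F} (hv : ∀ k, ‖v k‖ ≤ C) : ‖sumCLM C v hv‖ ≤ C :=
  LinearMap.mkContinuous_norm_le _ ((norm_nonneg _).trans (hv 0)) _

end sumCLM

/-! ### Evaluation and Fourier coefficients -/

/-- The weight `(1 + k)²`. It is submultiplicative, which makes the cosine series an algebra, and
at least `k` times `k^{a-1}` for `1 < a < 2`, which bounds the Hölder seminorm of the
derivative. -/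
noncomputable def weight (k : ℕ) : ℝ := (1 + (k : ℝ)) ^ 2

theorem one_le_weight (k : ℕ) : 1 ≤ weight k := by
  have : (0 : ℝ) ≤ k := k.cast_nonneg
  unfold weight
  nlinarith

theorem weight_pos (k : ℕ) : 0 < weight k := zero_lt_one.trans_le (one_le_weight k)

theorem abs_cos_div_weight_le (x : ℝ) (k : ℕ) : ‖Real.cos (k * x) / weight k‖ ≤ 1 := by
  rw [Real.norm_eq_abs, abs_div, abs_of_pos (weight_pos k)]
  exact (div_le_one (weight_pos k)).2 ((Real.abs_cos_le_one _).trans (one_le_weight k))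

/-- The value at `x` of the cosine series: `∑ u_k cos(kx) / (1 + k)²`. -/
noncomputable def ev (x : ℝ) : CosAlgebra →L[ℝ] ℝ :=
  sumCLM 1 (fun k => Real.cos (k * x) / weight k) (abs_cos_div_weight_le x)

theorem ev_basisVec (x : ℝ) (k : ℕ) : ev x (basisVec k) = Real.cos (k * x) / weight k :=
  sumCLM_basisVec _ _

theorem ev_apply (x : ℝ) (u : CosAlgebra) :
    ev x u = ∑' k, coord k u * (Real.cos (k * x) / weight k) := rfl

theorem abs_ev_le (x : ℝ) (u : CosAlgebra) : |ev x u| ≤ ‖u‖ := by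
  simpa using! norm_tsum_coord_smul_le (abs_cos_div_weight_le x) u

theorem integral_exp_int_mul (m : ℤ) :
    ∫ x in (0 : ℝ)..(2 * Real.pi), Complex.exp (Complex.I * m * x) =
      if m = 0 then (2 * Real.pi : ℂ) else 0 := by
  split_ifs with h
  · simp [h]
  · have hm : Complex.I * m ≠ 0 := mul_ne_zero Complex.I_ne_zero (by exact_mod_cast h)
    rw [integral_exp_mul_complex hm]
    have : Complex.exp (Complex.I * m * ((2 * Real.pi : ℝ) : ℂ)) = 1 := by
      rw [Complex.exp_eq_one_iff]
      exact ⟨m, by push_cast; ring⟩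
    rw [this]
    simp

/-- The `k`-th Fourier coefficient of `x ↦ cos(jx)`. -/
noncomputable def cosFourier (j : ℕ) (k : ℤ) : ℂ :=
  if k = 0 then (if j = 0 then 1 else 0) else if j = k.natAbs then 1 / 2 else 0

theorem integral_exp_mul_cos (j : ℕ) (k : ℤ) :
    ∫ x in (0 : ℝ)..(2 * Real.pi), Complex.exp (-(Complex.I * k * x)) * (Real.cos (j * x) : ℂ) =
      2 * Real.pi * cosFourier j k := by
  have h : ∀ x : ℝ, Complex.exp (-(Complex.I * k * x)) * (Real.cos (j * x) : ℂ) =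
      (1 / 2) * (Complex.exp (Complex.I * ((j - k : ℤ) : ℂ) * x)
        + Complex.exp (Complex.I * ((-j - k : ℤ) : ℂ) * x)) := fun x => by
    push_cast
    rw [Complex.cos, mul_div_assoc', mul_add, ← Complex.exp_add, ← Complex.exp_add]
    ring_nf
  have hi : ∀ m : ℤ, IntervalIntegrable (fun x : ℝ => Complex.exp (Complex.I * m * x))
      MeasureTheory.volume 0 (2 * Real.pi) := fun m =>
    Continuous.intervalIntegrable (by fun_prop) _ _
  simp_rw [h]
  rw [intervalIntegral.integral_const_mul, intervalIntegral.integral_add (hi _) (hi _),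
    integral_exp_int_mul, integral_exp_int_mul, cosFourier]
  split_ifs <;> first | omega | ring

theorem fourierCoeffOn_ev (u : CosAlgebra) (k : ℤ) :
    fourierCoeffOn Real.two_pi_pos (fun x => (ev x u : ℂ)) k =
      (coord k.natAbs u / weight k.natAbs : ℝ) * (if k = 0 then 1 else 1 / 2) := by
  have key : HasSum (fun j : ℕ => ∫ x in (0 : ℝ)..(2 * Real.pi),
      Complex.exp (-(Complex.I * k * x)) * ((coord j u * (Real.cos (j * x) / weight j) : ℝ) : ℂ))
      (∫ x in (0 : ℝ)..(2 * Real.pi), Complex.exp (-(Complex.I * k * x)) * (ev x u : ℂ)) := by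
    refine intervalIntegral.hasSum_integral_of_dominated_convergence
      (fun j _ => |coord j u|) (fun j => ?_) (fun j => ?_) ?_ ?_ ?_
    · exact Continuous.aestronglyMeasurable (by fun_prop)
    · refine Filter.Eventually.of_forall fun x _ => ?_
      have h1 : ‖Complex.exp (-(Complex.I * k * x))‖ = 1 := by
        rw [Complex.norm_exp]; simp
      rw [norm_mul, h1, one_mul, Complex.norm_real, norm_mul, Real.norm_eq_abs]
      exact mul_le_of_le_one_right (abs_nonneg _) (abs_cos_div_weight_le x j)
    · exact Filter.Eventually.of_forall fun x _ => (hasSum_abs_coord u).summable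
    · exact intervalIntegrable_const
    · refine Filter.Eventually.of_forall fun x _ => HasSum.mul_left _ ?_
      exact Complex.hasSum_ofReal.2
        (summable_norm_coord_smul (abs_cos_div_weight_le x) u).of_norm.hasSum
  have hterm : ∀ j : ℕ, ∫ x in (0 : ℝ)..(2 * Real.pi),
      Complex.exp (-(Complex.I * k * x)) * ((coord j u * (Real.cos (j * x) / weight j) : ℝ) : ℂ) =
      (coord j u / weight j : ℝ) * (2 * Real.pi * cosFourier j k) := fun j => by
    rw [← integral_exp_mul_cos, ← intervalIntegral.integral_const_mul]
    refine intervalIntegral.integral_congr fun x _ => ?_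
    push_cast
    ring
  simp only [hterm] at key
  have hsing := hasSum_single (f := fun j : ℕ => ((coord j u / weight j : ℝ) : ℂ) *
    (2 * Real.pi * cosFourier j k)) k.natAbs (fun j hj => by
      have : cosFourier j k = 0 := by
        unfold cosFourier
        split_ifs <;> first | rfl | omega
      simp [this])
  rw [torus_fourierCoeff_eq, key.unique hsing]
  have hπ : (Real.pi : ℂ) ≠ 0 := by exact_mod_cast Real.pi_ne_zero
  have : cosFourier k.natAbs k = if k = 0 then 1 else 1 / 2 := by
    unfold cosFourier
    split_ifs <;> first | rfl | omega
  rw [this]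
  field_simp

/-- The coordinates of a cosine series are determined by its Fourier coefficients. -/
theorem ev_injective {u v : CosAlgebra} (h : ∀ x, ev x u = ev x v) : u = v := by
  refine ext_coord fun k => ?_
  have hu := fourierCoeffOn_ev u k
  have hv := fourierCoeffOn_ev v k
  simp only [h] at hu
  rw [hu] at hv
  have hc : (if (k : ℤ) = 0 then (1 : ℂ) else 1 / 2) ≠ 0 := by split_ifs <;> norm_num
  have h2 := mul_right_cancel₀ hc hv
  have h3 : coord k u / weight k = coord k v / weight k := by
    simpa only [Int.natAbs_natCast] using Complex.ofReal_injective h2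
  exact (div_left_inj' (weight_pos k).ne').1 h3

/-! ### The Banach algebra structure -/

/-- The product `e_j e_k`, read off from `cos(jx) cos(kx) = (cos((j + k)x) + cos((j - k)x)) / 2`;
here `max j k - min j k` is `|j - k|`. -/
noncomputable def basisMul (j k : ℕ) : CosAlgebra :=
  (1 / (2 * (weight j * weight k))) • (weight (j + k) • basisVec (j + k)
    + weight (max j k - min j k) • basisVec (max j k - min j k))

theorem weight_add_le (j k : ℕ) : weight (j + k) ≤ weight j * weight k := by
  have hj : (0 : ℝ) ≤ j := j.cast_nonneg
  have hk : (0 : ℝ) ≤ k := k.cast_nonneg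
  unfold weight
  rw [← mul_pow]
  push_cast
  exact pow_le_pow_left₀ (by positivity) (by nlinarith) 2

theorem weight_mono {j k : ℕ} (h : j ≤ k) : weight j ≤ weight k := by
  have : (j : ℝ) ≤ k := by exact_mod_cast h
  unfold weight
  gcongr

theorem norm_basisMul_le (j k : ℕ) : ‖basisMul j k‖ ≤ 1 := by
  have hw := mul_pos (weight_pos j) (weight_pos k)
  rw [basisMul, norm_smul, Real.norm_of_nonneg (by positivity), one_div_mul_eq_div,
    div_le_one (by positivity)]
  refine (norm_add_le _ _).trans ?_
  rw [norm_smul, norm_smul, norm_basisVec, norm_basisVec, Real.norm_of_nonneg (weight_pos _).le,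
    Real.norm_of_nonneg (weight_pos _).le]
  have h1 := weight_add_le j k
  have h2 : weight (max j k - min j k) ≤ weight (j + k) := weight_mono (by omega)
  linarith

theorem ev_basisMul (x : ℝ) (j k : ℕ) :
    ev x (basisMul j k) = ev x (basisVec j) * ev x (basisVec k) := by
  have hj := (weight_pos j).ne'
  have hk := (weight_pos k).ne'
  have h1 := (weight_pos (j + k)).ne'
  have h2 := (weight_pos (max j k - min j k)).ne'
  have hc : Real.cos ((max j k - min j k : ℕ) * x) = Real.cos (j * x - k * x) := by
    rcases le_total j k with h | h
    · rw [max_eq_right h, min_eq_left h, Nat.cast_sub h, ← Real.cos_neg]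
      ring_nf
    · rw [max_eq_left h, min_eq_right h, Nat.cast_sub h]
      ring_nf
  simp only [basisMul, map_smul, map_add, ev_basisVec, smul_eq_mul]
  rw [mul_div_cancel₀ _ h1, mul_div_cancel₀ _ h2, hc, Nat.cast_add, add_mul, Real.cos_add,
    Real.cos_sub]
  field_simp
  ring

/-- The bilinear extension of `basisMul`. -/
noncomputable def mulCLM : CosAlgebra →L[ℝ] CosAlgebra →L[ℝ] CosAlgebra :=
  sumCLM 1 (fun j => sumCLM 1 (basisMul j) (norm_basisMul_le j))
    (fun j => norm_sumCLM_le (norm_basisMul_le j))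

theorem ev_mulCLM (x : ℝ) (u v : CosAlgebra) : ev x (mulCLM u v) = ev x u * ev x v := by
  have h : (ContinuousLinearMap.compL ℝ CosAlgebra CosAlgebra ℝ (ev x)).comp mulCLM =
      (ContinuousLinearMap.mul ℝ ℝ).bilinearComp (ev x) (ev x) :=
    clm_ext fun j => clm_ext fun k => by
      simp [mulCLM, sumCLM_basisVec, ev_basisMul]
  exact congrArg (fun f : CosAlgebra →L[ℝ] CosAlgebra →L[ℝ] ℝ => f u v) h

theorem ev_basisVec_zero (x : ℝ) : ev x (basisVec 0) = 1 := by
  simp [ev_basisVec, weight]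

/-- The pointwise product of cosine series. The ring axioms hold because evaluation is injective
and takes `mulCLM` to the product of reals. -/
noncomputable instance : NormedCommRing CosAlgebra :=
  { instNormedAddCommGroup with
    mul := fun u v => mulCLM u v
    one := basisVec 0
    left_distrib := fun u v w => map_add (mulCLM u) v w
    right_distrib := fun u v w => mulCLM.map_add₂ u v w
    zero_mul := fun u => mulCLM.map_zero₂ u
    mul_zero := fun u => map_zero (mulCLM u)
    mul_assoc := fun u v w => ev_injective fun x => by
      change ev x (mulCLM (mulCLM u v) w) = ev x (mulCLM u (mulCLM v w))
      simp only [ev_mulCLM, mul_assoc]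
    one_mul := fun u => ev_injective fun x => by
      change ev x (mulCLM (basisVec 0) u) = ev x u
      rw [ev_mulCLM, ev_basisVec_zero, one_mul]
    mul_one := fun u => ev_injective fun x => by
      change ev x (mulCLM u (basisVec 0)) = ev x u
      rw [ev_mulCLM, ev_basisVec_zero, mul_one]
    mul_comm := fun u v => ev_injective fun x => by
      change ev x (mulCLM u v) = ev x (mulCLM v u)
      rw [ev_mulCLM, ev_mulCLM, mul_comm]
    norm_mul_le := fun u v => by
      have h1 : ‖mulCLM‖ ≤ 1 := norm_sumCLM_le _
      calc ‖mulCLM u v‖ ≤ ‖mulCLM‖ * ‖u‖ * ‖v‖ := mulCLM.le_opNorm₂ u v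
        _ ≤ 1 * ‖u‖ * ‖v‖ := by gcongr
        _ = ‖u‖ * ‖v‖ := by rw [one_mul] }

theorem ev_mul (x : ℝ) (u v : CosAlgebra) : ev x (u * v) = ev x u * ev x v := ev_mulCLM x u v

theorem ev_one (x : ℝ) : ev x 1 = 1 := ev_basisVec_zero x

theorem ev_pow (x : ℝ) (u : CosAlgebra) (j : ℕ) : ev x (u ^ j) = ev x u ^ j := by
  induction j with
  | zero => rw [pow_zero, pow_zero, ev_one]
  | succ j ih => rw [pow_succ, pow_succ, ev_mul, ih]

noncomputable instance : NormedAlgebra ℝ CosAlgebra where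
  toAlgebra := Algebra.ofModule
    (fun r u v => ev_injective fun x => by
      simp only [ev_mul, map_smul, smul_eq_mul, mul_assoc])
    (fun r u v => ev_injective fun x => by
      simp only [ev_mul, map_smul, smul_eq_mul]; ring)
  norm_smul_le := fun r u => (norm_smul r u).le

instance : NormOneClass CosAlgebra := ⟨norm_basisVec 0⟩

/-! ### Fourier multipliers -/

section Multiplier

theorem norm_smul_basisVec_le {C : ℝ} {m : ℕ → ℝ} (hm : ∀ k, |m k| ≤ C) (k : ℕ) :
    ‖m k • basisVec k‖ ≤ C := by
  rw [norm_smul, norm_basisVec, mul_one]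
  exact hm k

/-- The diagonal operator `u_k ↦ m_k u_k`, for `m` bounded by `C`. -/
noncomputable def multiplier (C : ℝ) (m : ℕ → ℝ) (hm : ∀ k, |m k| ≤ C) :
    CosAlgebra →L[ℝ] CosAlgebra :=
  sumCLM C (fun k => m k • basisVec k) (norm_smul_basisVec_le hm)

theorem coord_multiplier {C : ℝ} {m : ℕ → ℝ} (hm : ∀ k, |m k| ≤ C) (u : CosAlgebra) (k : ℕ) :
    coord k (multiplier C m hm u) = m k * coord k u := by
  have h : (coord k).comp (multiplier C m hm) = m k • coord k := clm_ext fun j => by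
    simp only [multiplier, ContinuousLinearMap.comp_apply, sumCLM_basisVec, map_smul,
      coord_basisVec, smul_apply, smul_eq_mul]
    split_ifs with hk
    · rw [hk]
    · rw [mul_zero, mul_zero]
  exact congrArg (fun f : CosAlgebra →L[ℝ] ℝ => f u) h

theorem norm_multiplier_le {C : ℝ} {m : ℕ → ℝ} (hm : ∀ k, |m k| ≤ C) :
    ‖multiplier C m hm‖ ≤ C :=
  norm_sumCLM_le _

/-- On cosine series the Fourier multiplier with an even bounded symbol is the diagonal operator. -/
theorem fourierMultiplier_ev {C : ℝ} {m : ℕ → ℝ} (hm : ∀ k, |m k| ≤ C) {σ : ℤ → ℂ}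
    (hσ : ∀ k, σ k = m k.natAbs) (u : CosAlgebra) :
    fourierMultiplier σ (fun x => (ev x u : ℂ)) = fun x => (ev x (multiplier C m hm u) : ℂ) := by
  funext x
  -- `t k` is the coefficient of `cos(kx)`; the modes `k` and `-k` contribute half of it each.
  set t : ℕ → ℂ := fun k => ((m k * (coord k u / weight k) : ℝ) : ℂ) with ht
  have hts : Summable fun k => ‖t k‖ := by
    refine Summable.of_nonneg_of_le (fun _ => norm_nonneg _) (fun k => ?_)
      ((hasSum_abs_coord u).summable.mul_left C)
    rw [ht, Complex.norm_real, norm_mul, norm_div, Real.norm_eq_abs, Real.norm_eq_abs,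
      Real.norm_of_nonneg (weight_pos k).le]
    exact mul_le_mul (hm k) (div_le_self (abs_nonneg _) (one_le_weight k))
      (div_nonneg (abs_nonneg _) (weight_pos k).le)
      ((abs_nonneg _).trans (hm 0))
  set f : ℤ → ℂ := fun k => σ k * fourierCoeffOn Real.two_pi_pos (fun x => (ev x u : ℂ)) k
    * Complex.exp (Complex.I * k * x) with hf
  have hfk : ∀ k : ℤ, f k = t k.natAbs * (if k = 0 then 1 else 1 / 2)
      * Complex.exp (Complex.I * k * x) := fun k => by
    simp only [hf, ht, hσ, fourierCoeffOn_ev]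
    push_cast
    ring
  have hnorm : ∀ k : ℤ, ‖f k‖ ≤ ‖t k.natAbs‖ := fun k => by
    have h1 : ‖Complex.exp (Complex.I * k * x)‖ = 1 := by rw [Complex.norm_exp]; simp
    have h2 : ‖(if k = 0 then (1 : ℂ) else 1 / 2)‖ ≤ 1 := by split_ifs <;> norm_num
    rw [hfk, norm_mul, norm_mul, h1, mul_one]
    exact mul_le_of_le_one_right (norm_nonneg _) h2
  have hs1 : Summable fun k : ℕ => f k :=
    Summable.of_norm_bounded hts fun k => by simpa using hnorm k
  have hs2 : Summable fun k : ℕ => f (-k) :=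
    Summable.of_norm_bounded hts fun k => by simpa using hnorm (-k)
  have hsum := (hs1.hasSum.add hs2.hasSum).sub (hasSum_ite_eq 0 (f 0))
  have hev := Complex.hasSum_ofReal.2
    (summable_norm_coord_smul (abs_cos_div_weight_le x) (multiplier C m hm u)).of_norm.hasSum
  refine (hs1.hasSum.of_nat_of_neg hs2.hasSum).tsum_eq.trans (hsum.unique ?_)
  refine (congrArg (HasSum · _) (funext fun k => ?_)).mpr hev
  have hw : (weight k : ℂ) ≠ 0 := by exact_mod_cast (weight_pos k).ne'
  rw [hfk, hfk, hfk]
  simp only [Int.natAbs_natCast, Int.natAbs_neg, ht, coord_multiplier, smul_eq_mul]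
  rcases eq_or_ne k 0 with rfl | hk
  · simp [div_eq_mul_inv, mul_assoc]
  · have hk' : (k : ℤ) ≠ 0 := by exact_mod_cast hk
    have hk'' : -(k : ℤ) ≠ 0 := neg_ne_zero.2 hk'
    rw [if_neg hk', if_neg hk'', if_neg hk]
    push_cast
    rw [Complex.cos]
    field_simp
    ring_nf

end Multiplier

/-! ### The embedding in the Hölder space -/

section Holder

theorem abs_deriv_coeff_le (x : ℝ) (k : ℕ) : ‖-(k * Real.sin (k * x)) / weight k‖ ≤ 1 := by
  have hk : (0 : ℝ) ≤ k := k.cast_nonneg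
  rw [norm_div, norm_neg, norm_mul, Real.norm_of_nonneg (weight_pos k).le,
    Real.norm_of_nonneg hk, div_le_one (weight_pos k), Real.norm_eq_abs]
  have := Real.abs_sin_le_one (k * x)
  unfold weight
  nlinarith [abs_nonneg (Real.sin (k * x))]

/-- The value at `x` of the derivative of the cosine series. -/
noncomputable def evDeriv (x : ℝ) : CosAlgebra →L[ℝ] ℝ :=
  sumCLM 1 (fun k => -(k * Real.sin (k * x)) / weight k) (abs_deriv_coeff_le x)

theorem abs_evDeriv_le (x : ℝ) (u : CosAlgebra) : |evDeriv x u| ≤ ‖u‖ := by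
  simpa using! norm_tsum_coord_smul_le (abs_deriv_coeff_le x) u

theorem hasDerivAt_ev (u : CosAlgebra) (x : ℝ) :
    HasDerivAt (fun x => ev x u) (evDeriv x u) x := by
  refine hasDerivAt_tsum (g := fun k x => coord k u • (Real.cos (k * x) / weight k))
    (g' := fun k x => coord k u • (-(k * Real.sin (k * x)) / weight k))
    (y₀ := 0) (hasSum_abs_coord u).summable (fun k y => ?_) (fun k y => ?_)
    (summable_norm_coord_smul (abs_cos_div_weight_le 0) u).of_norm x
  · have h : HasDerivAt (fun y => Real.cos (k * y)) (-(k * Real.sin (k * y))) y := by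
      simpa [mul_comm] using ((hasDerivAt_id y).const_mul (k : ℝ)).cos
    exact (h.div_const (weight k)).const_mul (coord k u)
  · rw [norm_smul, Real.norm_eq_abs]
    exact mul_le_of_le_one_right (abs_nonneg _) (abs_deriv_coeff_le y k)

theorem deriv_ev (u : CosAlgebra) : deriv (fun x => ev x u) = fun x => evDeriv x u :=
  funext fun x => (hasDerivAt_ev u x).deriv

theorem contDiff_ev (u : CosAlgebra) : ContDiff ℝ 1 fun x => ev x u := by
  refine contDiff_one_iff_deriv.2 ⟨fun x => (hasDerivAt_ev u x).differentiableAt, ?_⟩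
  rw [deriv_ev]
  refine continuous_tsum (f := fun k x => coord k u • (-(k * Real.sin (k * x)) / weight k))
    (fun k => by fun_prop) (hasSum_abs_coord u).summable fun k x => ?_
  rw [norm_smul, Real.norm_eq_abs]
  exact mul_le_of_le_one_right (abs_nonneg _) (abs_deriv_coeff_le x k)

theorem abs_sin_sub_sin_le_rpow {θ : ℝ} (h0 : 0 < θ) (h1 : θ ≤ 1) (s t : ℝ) :
    |Real.sin s - Real.sin t| ≤ 2 * |s - t| ^ θ := by
  have hp : 0 ≤ |s - t| ^ θ := by positivity
  rcases le_or_gt |s - t| 1 with h | h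
  · have h2 : |s - t| ≤ |s - t| ^ θ := by
      simpa using Real.rpow_le_rpow_of_exponent_ge_of_imp (abs_nonneg (s - t)) h h1
        (fun _ h => absurd h one_ne_zero)
    linarith [Real.abs_sin_sub_sin_le s t]
  · have h2 : 1 ≤ |s - t| ^ θ := Real.one_le_rpow h.le h0.le
    have h3 : |Real.sin s - Real.sin t| ≤ 2 := by
      rw [abs_le]
      constructor <;> linarith [Real.sin_le_one s, Real.neg_one_le_sin s, Real.sin_le_one t,
        Real.neg_one_le_sin t]
    linarith

theorem abs_deriv_coeff_sub_le {θ : ℝ} (h0 : 0 < θ) (h1 : θ ≤ 1) (x y : ℝ) (k : ℕ) :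
    ‖-(k * Real.sin (k * x)) / weight k - -(k * Real.sin (k * y)) / weight k‖ ≤
      2 * |x - y| ^ θ := by
  have hk : (0 : ℝ) ≤ k := k.cast_nonneg
  have hp : 0 ≤ |x - y| ^ θ := by positivity
  have hkθ : (k : ℝ) ^ θ ≤ 1 + k :=
    calc (k : ℝ) ^ θ ≤ (1 + k : ℝ) ^ θ := Real.rpow_le_rpow hk (by linarith) h0.le
      _ ≤ (1 + k : ℝ) ^ (1 : ℝ) := Real.rpow_le_rpow_of_exponent_le (by linarith) h1
      _ = 1 + k := Real.rpow_one _
  have hs := abs_sin_sub_sin_le_rpow h0 h1 (k * x) (k * y)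
  rw [← mul_sub, abs_mul, abs_of_nonneg hk, Real.mul_rpow hk (abs_nonneg _)] at hs
  rw [← sub_div, show -(k * Real.sin (k * x)) - -(k * Real.sin (k * y)) =
    -(k * (Real.sin (k * x) - Real.sin (k * y))) by ring, norm_div, norm_neg, norm_mul,
    Real.norm_of_nonneg (weight_pos k).le, Real.norm_of_nonneg hk,
    div_le_iff₀ (weight_pos k), Real.norm_eq_abs]
  calc (k : ℝ) * |Real.sin (k * x) - Real.sin (k * y)|
      ≤ (1 + k) * (2 * ((1 + k) * |x - y| ^ θ)) := by gcongr <;> nlinarith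
    _ = 2 * |x - y| ^ θ * weight k := by unfold weight; ring

theorem abs_evDeriv_sub_le {θ : ℝ} (h0 : 0 < θ) (h1 : θ ≤ 1) (x y : ℝ) (u : CosAlgebra) :
    |evDeriv x u - evDeriv y u| ≤ 2 * ‖u‖ * |x - y| ^ θ := by
  have h := norm_tsum_coord_smul_le (abs_deriv_coeff_sub_le h0 h1 x y) u
  simp only [smul_sub] at h
  rw [(summable_norm_coord_smul (abs_deriv_coeff_le x) u).of_norm.tsum_sub
    (summable_norm_coord_smul (abs_deriv_coeff_le y) u).of_norm] at h
  calc |evDeriv x u - evDeriv y u| ≤ 2 * |x - y| ^ θ * ‖u‖ := h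
    _ = 2 * ‖u‖ * |x - y| ^ θ := by ring

theorem integral_ev (u : CosAlgebra) :
    ∫ x in (0 : ℝ)..(2 * Real.pi), ev x u = 2 * Real.pi * coord 0 u := by
  have h := fourierCoeffOn_ev u 0
  rw [torus_fourierCoeff_eq] at h
  have hπ : (Real.pi : ℂ) ≠ 0 := by exact_mod_cast Real.pi_ne_zero
  simp only [Int.cast_zero, mul_zero, zero_mul, neg_zero, Complex.exp_zero, one_mul,
    intervalIntegral.integral_ofReal, if_true, mul_one, Int.natAbs_zero] at h
  rw [one_div, inv_mul_eq_iff_eq_mul₀ (mul_ne_zero two_ne_zero hπ)] at h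
  have h0 : weight 0 = 1 := by simp [weight]
  rw [h0, div_one] at h
  exact_mod_cast h

theorem ev_mem_periodicHolderZeroEven {a : ℝ} (ha1 : 1 < a) (ha2 : a < 2) {u : CosAlgebra}
    (hu : coord 0 u = 0) : (fun x => ev x u) ∈ periodicHolderZeroEven a := by
  refine ⟨⟨fun x => ?_, contDiff_ev u, 2 * ‖u‖, fun x y => ?_⟩, fun x => ?_, ?_⟩
  · simp only [ev_apply]
    refine tsum_congr fun k => ?_
    rw [mul_add, Real.cos_add_nat_mul_two_pi]
  · rw [deriv_ev]
    exact abs_evDeriv_sub_le (by linarith) (by linarith) x y u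
  · simp only [ev_apply, mul_neg, Real.cos_neg]
  · rw [integral_ev, hu, mul_zero]

theorem holderNorm_ev_le {a : ℝ} (ha1 : 1 < a) (ha2 : a < 2) (u : CosAlgebra) :
    holderNorm a (fun x => ev x u) ≤ 4 * ‖u‖ := by
  have h1 : ⨆ x, |ev x u| ≤ ‖u‖ := ciSup_le fun x => abs_ev_le x u
  have h2 : ⨆ x, |evDeriv x u| ≤ ‖u‖ := ciSup_le fun x => abs_evDeriv_le x u
  have h3 : ⨆ p : ℝ × ℝ, |evDeriv p.1 u - evDeriv p.2 u| / |p.1 - p.2| ^ (a - 1) ≤ 2 * ‖u‖ :=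
    ciSup_le fun p => div_le_of_le_mul₀ (by positivity) (by positivity)
      (abs_evDeriv_sub_le (by linarith) (by linarith) p.1 p.2 u)
  rw [holderNorm, deriv_ev]
  linarith

/-- The projection onto the modes `k ≥ N`. -/
noncomputable def tail (N : ℕ) : CosAlgebra →L[ℝ] CosAlgebra :=
  multiplier 1 (fun k => if k < N then 0 else 1) (fun k => by split_ifs <;> simp)

theorem coord_tail (N : ℕ) (u : CosAlgebra) (k : ℕ) :
    coord k (tail N u) = if k < N then 0 else coord k u := by
  rw [tail, coord_multiplier]
  split_ifs <;> simp

theorem norm_tail_le (N : ℕ) (u : CosAlgebra) : ‖tail N u‖ ≤ ‖u‖ := by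
  simpa using! (tail N).le_of_opNorm_le (norm_multiplier_le _) u

theorem tail_one_of_coord_zero {u : CosAlgebra} (hu : coord 0 u = 0) : tail 1 u = u :=
  ext_coord fun k => by
    rw [coord_tail]
    split_ifs with h
    · rw [Nat.lt_one_iff.1 h, hu]
    · rfl

/-- The bounded embedding of cosine series in `C^a_{0,even}(𝕋)`; the mean is discarded. -/
noncomputable def toHolder (a : ℝ) (ha1 : 1 < a) (ha2 : a < 2) :
    CosAlgebra →L[ℝ] HolderZeroEven a :=
  LinearMap.mkContinuous
    { toFun := fun u => (⟨fun x => ev x (tail 1 u), ev_mem_periodicHolderZeroEven ha1 ha2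
        (by rw [coord_tail, if_pos zero_lt_one])⟩ : HolderZeroEven a)
      map_add' := fun u v => Subtype.ext (funext fun x => by
        change ev x (tail 1 (u + v)) = ev x (tail 1 u) + ev x (tail 1 v)
        rw [map_add, map_add])
      map_smul' := fun r u => Subtype.ext (funext fun x => by
        change ev x (tail 1 (r • u)) = r * ev x (tail 1 u)
        rw [map_smul, map_smul, smul_eq_mul]) }
    4 fun u => (holderNorm_ev_le ha1 ha2 (tail 1 u)).trans (by
      gcongr
      exact norm_tail_le 1 u)

theorem toHolder_apply {a : ℝ} (ha1 : 1 < a) (ha2 : a < 2) {u : CosAlgebra}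
    (hu : coord 0 u = 0) (x : ℝ) : toHolder a ha1 ha2 u x = ev x u := by
  change ev x (tail 1 u) = ev x u
  rw [tail_one_of_coord_zero hu]

end Holder

/-! ### Analytic superposition and the equation for cosine series -/

/-- The superposition operator `u ↦ n(u)` factors near `0` as `u² M(u)` with `M` analytic. -/
theorem exists_analyticAt_quadratic_factor {n : ℝ → ℝ} (hn : AnalyticAt ℝ n 0) (hn0 : n 0 = 0)
    (hn1 : deriv n 0 = 0) :
    ∃ M : CosAlgebra → CosAlgebra, AnalyticAt ℝ M 0 ∧
      ∀ᶠ u in 𝓝 (0 : CosAlgebra), ∀ x, n (ev x u) = ev x (u ^ 2 * M u) := by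
  obtain ⟨p, hp⟩ := hn
  have hp0 : p.coeff 0 = 0 := by
    rw [FormalMultilinearSeries.coeff, hp.coeff_zero, hn0]
  have hp1 : p.coeff 1 = 0 := hp.deriv.symm.trans hn1
  set q := FormalMultilinearSeries.ofScalars CosAlgebra (fun j => p.coeff (j + 2)) with hq
  -- Shifting the coefficients of `n` by two preserves geometric growth.
  have hqr : 0 < q.radius := by
    obtain ⟨C, r, hC, hr, h⟩ := p.le_mul_pow_of_radius_pos hp.radius_pos
    have : 0 < (⟨r⁻¹, by positivity⟩ : NNReal) := inv_pos.2 hr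
    refine lt_of_lt_of_le (ENNReal.coe_pos.2 this) (q.le_radius_of_bound (C * r ^ 2) fun j => ?_)
    rw [hq, FormalMultilinearSeries.ofScalars_norm,
      ← FormalMultilinearSeries.norm_apply_eq_norm_coef]
    calc ‖p (j + 2)‖ * (r⁻¹) ^ j ≤ C * r ^ (j + 2) * (r⁻¹) ^ j := by gcongr; exact h _
      _ = C * r ^ 2 := by rw [inv_pow, pow_add]; field_simp
  have hball := q.hasFPowerSeriesOnBall hqr
  refine ⟨q.sum, hball.analyticAt, ?_⟩
  obtain ⟨δ, hδ, hnδ⟩ := Metric.eventually_nhds_iff.1 hp.eventually_hasSum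
  filter_upwards [Metric.ball_mem_nhds (0 : CosAlgebra) hδ,
    hball.hasFPowerSeriesAt.eventually_hasSum] with u hu hsum x
  have hx : dist (ev x u) 0 < δ := by
    rw [Real.dist_0_eq_abs]
    exact (abs_ev_le x u).trans_lt (mem_ball_zero_iff.1 hu)
  have h1 := hnδ hx
  simp only [FormalMultilinearSeries.apply_eq_pow_smul_coeff, smul_eq_mul, zero_add] at h1
  have h2 := (ev x).hasSum hsum
  simp only [hq, FormalMultilinearSeries.ofScalars_apply_eq, map_smul, ev_pow, smul_eq_mul,
    zero_add] at h2
  rw [← hasSum_nat_add_iff' 2] at h1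
  simp only [Finset.sum_range_succ, Finset.sum_range_zero, hp0, hp1, mul_zero, add_zero,
    sub_zero] at h1
  rw [ev_mul, ev_pow]
  refine h1.unique ?_
  convert! h2.mul_left (ev x u ^ 2) using 2
  ring

/-- The steady equation, mode by mode. The mode `k = 0` is satisfied by the choice of `B_φ`. -/
theorem isSteadySolution_ev {β c : ℝ} (hβ : 0 ≤ β) (hc : 0 < c) {n : ℝ → ℝ} {u N : CosAlgebra}
    (hN : ∀ x, n (ev x u) = ev x N) (hu : coord 0 u = 0)
    (h : ∀ k : ℕ, k ≠ 0 → (c + β * k ^ 2 - 1 / k ^ 2) * coord k u = coord k N) :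
    IsSteadySolution β n c (fun x => ev x u) := by
  have hpos : ∀ k : ℕ, 0 < c + β * (k : ℝ) ^ 2 := fun k => by positivity
  have hl : ∀ k : ℕ, |1 / (c + β * (k : ℝ) ^ 2)| ≤ 1 / c := fun k => by
    rw [abs_of_pos (one_div_pos.2 (hpos k))]
    exact one_div_le_one_div_of_le hc (le_add_of_nonneg_right (by positivity))
  have hd : ∀ k : ℕ, |if k = 0 then (0 : ℝ) else 1 / (k : ℝ) ^ 2| ≤ 1 := fun k => by
    split_ifs with hk
    · simp
    · have : (1 : ℝ) ≤ k := by exact_mod_cast Nat.one_le_iff_ne_zero.2 hk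
      rw [abs_of_nonneg (by positivity)]
      exact (div_le_one (by positivity)).2 (one_le_pow₀ this)
  have habs : ∀ k : ℤ, ((k.natAbs : ℂ)) ^ 2 = (k : ℂ) ^ 2 := fun k => by
    rw [← Int.cast_natCast, ← Int.cast_pow, Int.natCast_natAbs, sq_abs, Int.cast_pow]
  have hL : ∀ v : CosAlgebra, opL β c (fun x => (ev x v : ℂ)) =
      fun x => (ev x (multiplier _ _ hl v) : ℂ) := fun v =>
    fourierMultiplier_ev hl (fun k => by push_cast; rw [habs]) v
  have hD : ∀ v : CosAlgebra, invDSq (fun x => (ev x v : ℂ)) =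
      fun x => (ev x (multiplier _ _ hd v) : ℂ) := fun v =>
    fourierMultiplier_ev hd (fun k => by
      rcases eq_or_ne k 0 with rfl | hk
      · simp
      · rw [if_neg hk, if_neg (Int.natAbs_ne_zero.2 hk)]
        push_cast
        rw [habs]) v
  have hB : constB n c (fun x => ev x u) = coord 0 N / c := by
    have hπ := Real.pi_ne_zero
    simp only [constB, hN, integral_ev]
    field_simp
  have key : -u + multiplier _ _ hd (multiplier _ _ hl u) + multiplier _ _ hl N =
      (coord 0 N / c) • basisVec 0 := ext_coord fun k => by
    simp only [map_add, map_neg, map_smul, coord_multiplier, coord_basisVec, smul_eq_mul]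
    rcases eq_or_ne k 0 with rfl | hk
    · simp [hu]
      ring
    · have hk' : (k : ℝ) ≠ 0 := by exact_mod_cast hk
      have h3 := (hpos k).ne'
      rw [if_neg hk, if_neg hk, ← h k hk]
      field_simp
      ring
  intro x
  have hx := congrArg (ev x) key
  simp only [map_add, map_neg, map_smul, ev_basisVec_zero, smul_eq_mul, mul_one] at hx
  simp only [hN]
  rw [hL, hL, hD, hB, ← hx]
  push_cast
  ring

/-! ### Bifurcation from the simple mode `cos` -/

/-- The function `cos` as an element of `CosAlgebra`. -/
noncomputable def cosVec : CosAlgebra := weight 1 • basisVec 1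

theorem ev_cosVec (x : ℝ) : ev x cosVec = Real.cos x := by
  rw [cosVec, map_smul, ev_basisVec, smul_eq_mul, mul_div_cancel₀ _ (weight_pos 1).ne',
    Nat.cast_one, one_mul]

theorem coord_cosVec (k : ℕ) : coord k cosVec = if k = 1 then weight 1 else 0 := by
  rw [cosVec, map_smul, coord_basisVec, smul_eq_mul, mul_ite, mul_one, mul_zero]

/-- The symbol `1 - β + βk² - k⁻²` of the linearisation at the bifurcation point, up to sign and
after cancelling the factor `(1 - β + βk²)⁻¹`. It is used for `k ≥ 1` only. -/
noncomputable def symb (β : ℝ) (k : ℕ) : ℝ := 1 - β + β * k ^ 2 - 1 / k ^ 2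

theorem le_symb {β : ℝ} (hβ0 : 0 ≤ β) {k : ℕ} (hk : 2 ≤ k) : 3 / 4 ≤ symb β k := by
  have hk' : (2 : ℝ) ≤ k := by exact_mod_cast hk
  have h4 : (4 : ℝ) ≤ (k : ℝ) ^ 2 := by nlinarith
  have h1 : 1 / (k : ℝ) ^ 2 ≤ 1 / 4 := one_div_le_one_div_of_le (by norm_num) h4
  have h2 : β ≤ β * (k : ℝ) ^ 2 := le_mul_of_one_le_right hβ0 (by linarith)
  unfold symb
  linarith

/-- The inverse of `symb` on the modes `k ≥ 2`, where it is invertible. On the mode `k = 1`, which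
carries the unknown `μ` in place of a Fourier mode of the solution, it is the identity; the mean is
discarded. -/
noncomputable def pseudoInv (β : ℝ) (k : ℕ) : ℝ :=
  if k = 0 then 0 else if k = 1 then 1 else 1 / symb β k

theorem abs_pseudoInv_le {β : ℝ} (hβ0 : 0 ≤ β) (k : ℕ) : |pseudoInv β k| ≤ 4 / 3 := by
  unfold pseudoInv
  split_ifs with h0 h1
  · norm_num
  · norm_num
  · have h := le_symb hβ0 (k := k) (by omega)
    rw [abs_of_nonneg (one_div_nonneg.2 (by linarith)), div_le_div_iff₀ (by linarith) (by norm_num)]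
    linarith

/-- The reduced system, solved along an analytic curve `v(ε)`. The unknown `v` encodes the pair
`(μ, ψ)`: its coordinate `1` is `weight 1 * μ`, and its modes `k ≥ 2` form `ψ`. -/
theorem exists_amplitude_curve {β : ℝ} (hβ0 : 0 ≤ β) {M : CosAlgebra → CosAlgebra}
    (hM : AnalyticAt ℝ M 0) :
    ∃ v : ℝ → CosAlgebra, AnalyticAt ℝ v 0 ∧ v 0 = 0 ∧ ∀ᶠ ε in 𝓝 (0 : ℝ), ∀ k : ℕ, k ≠ 0 →
      (symb β k + coord 1 (v ε) / weight 1) * coord k (cosVec + tail 2 (v ε)) =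
        ε * coord k ((cosVec + tail 2 (v ε)) ^ 2 * M (ε • (cosVec + tail 2 (v ε)))) := by
  set T := multiplier _ _ (abs_pseudoInv_le hβ0) with hT
  set G : ℝ × CosAlgebra → CosAlgebra := fun p =>
    T (p.1 • ((cosVec + tail 2 p.2) ^ 2 * M (p.1 • (cosVec + tail 2 p.2)))
      - (coord 1 p.2 / weight 1) • tail 2 p.2) with hGdef
  have hG : AnalyticAt ℝ G 0 := by
    have hΦ : AnalyticAt ℝ (fun p : ℝ × CosAlgebra => cosVec + tail 2 p.2) 0 :=
      analyticAt_const.add ((tail 2).analyticAt _ |>.comp analyticAt_snd)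
    have hε : AnalyticAt ℝ (fun p : ℝ × CosAlgebra => p.1) 0 := analyticAt_fst
    have hM' : AnalyticAt ℝ (fun p : ℝ × CosAlgebra => M (p.1 • (cosVec + tail 2 p.2))) 0 :=
      AnalyticAt.comp_of_eq hM (hε.smul hΦ) (by simp)
    have hμ : AnalyticAt ℝ (fun p : ℝ × CosAlgebra => coord 1 p.2 / weight 1) 0 :=
      ((coord 1).analyticAt _ |>.comp analyticAt_snd).div_const
    have ht : AnalyticAt ℝ (fun p : ℝ × CosAlgebra => tail 2 p.2) 0 :=
      (tail 2).analyticAt _ |>.comp analyticAt_snd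
    exact (T.analyticAt _).comp ((hε.smul ((hΦ.pow 2).mul hM')).sub (hμ.smul ht))
  -- At `ε = 0` only the quadratic term `-T (μ ψ)` is left.
  have hG' : HasFDerivAt (fun v => G (0, v)) (0 : CosAlgebra →L[ℝ] CosAlgebra) 0 := by
    have h1 := ((coord 1).hasFDerivAt (x := 0)).mul_const (weight 1)⁻¹
    have h2 := T.hasFDerivAt.comp 0 (h1.smul ((tail 2).hasFDerivAt (x := 0))).neg
    convert! h2 using 1
    · funext v
      simp [hGdef, div_eq_mul_inv]
    · ext u
      simp
  obtain ⟨v, hv, hv0, hfix⟩ := exists_analyticAt_fixedPoint hG (by simp [hGdef]) hG'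
  refine ⟨v, hv, hv0, hfix.mono fun ε hε k hk => ?_⟩
  have hc := congrArg (coord k) hε
  simp only [hGdef, hT, coord_multiplier, map_sub, map_smul, smul_eq_mul, coord_tail] at hc
  simp only [map_add, coord_cosVec, coord_tail]
  rcases eq_or_ne k 1 with rfl | hk1
  -- On the mode `k = 1` the symbol vanishes and the equation reads `weight 1 * μ = ε R_1`.
  · have hw := (weight_pos 1).ne'
    simp [pseudoInv] at hc
    simp [symb]
    rw [← hc]
    field_simp
  · have h2 : ¬ k < 2 := by omega
    have hs : symb β k ≠ 0 := by linarith [le_symb hβ0 (k := k) (by omega)]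
    rw [pseudoInv, if_neg hk, if_neg hk1, if_neg h2, one_div, eq_sub_iff_add_eq] at hc
    rw [if_neg hk1, if_neg h2, zero_add]
    field_simp at hc ⊢
    linarith

end CosAlgebra

open CosAlgebra in
theorem mainTheorem1 (a β : ℝ) (ha1 : 1 < a) (ha2 : a < 2) (hβ0 : 0 ≤ β) (hβ1 : β < 1)
    (n : ℝ → ℝ) (hn : AnalyticOnNhd ℝ n Set.univ) (hn_ne : n ≠ 0)
    (hn0 : n 0 = 0) (hn1 : deriv n 0 = 0) :
    ∃ (ε₀ : ℝ) (c : ℝ → ℝ) (φ : ℝ → HolderZeroEven a),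
      0 < ε₀ ∧
      AnalyticOnNhd ℝ c (Set.Ioo (-ε₀) ε₀) ∧
      AnalyticOnNhd ℝ φ (Set.Ioo (-ε₀) ε₀) ∧
      c 0 = 1 - β ∧ φ 0 = 0 ∧
      HasDerivAt φ (⟨Real.cos, HolderZeroEven.cos_mem a ha1 ha2⟩ : HolderZeroEven a) 0 ∧
      (∀ ε ∈ Set.Ioo (-ε₀) ε₀, 0 < c ε ∧ IsSteadySolution β n (c ε) (φ ε)) ∧
      (∀ ε ∈ Set.Ioo (-ε₀) ε₀, ε ≠ 0 → φ ε ≠ 0) := by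
  obtain ⟨M, hM, hnM⟩ := exists_analyticAt_quadratic_factor (hn 0 trivial) hn0 hn1
  obtain ⟨v, hv, hv0, hsol⟩ := exists_amplitude_curve hβ0 hM
  set c : ℝ → ℝ := fun ε => 1 - β + coord 1 (v ε) / weight 1 with hcdef
  set w : ℝ → CosAlgebra := fun ε => cosVec + tail 2 (v ε) with hwdef
  have hw0 : ∀ ε, coord 0 (w ε) = 0 := fun ε => by simp [hwdef, coord_cosVec, coord_tail]
  have hw1 : ∀ ε, coord 1 (w ε) = weight 1 := fun ε => by simp [hwdef, coord_cosVec, coord_tail]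
  have hu0 : ∀ ε, coord 0 (ε • w ε) = 0 := fun ε => by rw [map_smul, hw0, smul_zero]
  have hca : ∀ {ε}, AnalyticAt ℝ v ε → AnalyticAt ℝ c ε := fun h =>
    analyticAt_const.add (((coord 1).analyticAt _).comp h).div_const
  have hwa : ∀ {ε}, AnalyticAt ℝ v ε → AnalyticAt ℝ w ε := fun h =>
    analyticAt_const.add (((tail 2).analyticAt _).comp h)
  have hc0 : c 0 = 1 - β := by simp [hcdef, hv0]
  have hcpos : ∀ᶠ ε in 𝓝 (0 : ℝ), 0 < c ε :=
    (hca hv).continuousAt.eventually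
      (lt_mem_nhds (by rw [hc0]; linarith))
  have hsmall : Filter.Tendsto (fun ε : ℝ => ε • w ε) (𝓝 0) (𝓝 0) := by
    have h : Filter.Tendsto (fun ε : ℝ => ε • w ε) (𝓝 0) (𝓝 ((0 : ℝ) • w 0)) :=
      continuousAt_id.smul (hwa hv).continuousAt
    rwa [zero_smul] at h
  obtain ⟨ε₀, hε₀, hall⟩ := Metric.eventually_nhds_iff.1
    (((hv.eventually_analyticAt.and hcpos).and hsol).and (hsmall.eventually hnM))
  have hall' : ∀ ε ∈ Set.Ioo (-ε₀) ε₀, _ := fun ε hε => hall (y := ε) (by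
    rw [Real.dist_0_eq_abs]
    exact abs_lt.2 hε)
  refine ⟨ε₀, c, fun ε => toHolder a ha1 ha2 (ε • w ε), hε₀, fun ε hε => hca (hall' ε hε).1.1.1,
    fun ε hε => ?_, hc0, ?_, ?_, fun ε hε => ?_, fun ε hε hne h => ?_⟩
  · exact ((toHolder a ha1 ha2).analyticAt _).comp
      (analyticAt_id.smul (hwa (hall' ε hε).1.1.1))
  · simp
  · have h1 : HasDerivAt (fun ε : ℝ => ε • w ε) cosVec 0 := by
      have h := (hasDerivAt_id (0 : ℝ)).smul (hwa hv).differentiableAt.hasDerivAt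
      have hw : (id (0 : ℝ)) • deriv w 0 + (1 : ℝ) • w 0 = cosVec := by simp [hwdef, hv0]
      rw [hw] at h
      exact h
    have hcos : toHolder a ha1 ha2 cosVec = ⟨Real.cos, HolderZeroEven.cos_mem a ha1 ha2⟩ :=
      Subtype.ext (funext fun x =>
        (toHolder_apply ha1 ha2 (by simp [coord_cosVec]) x).trans (ev_cosVec x))
    rw [← hcos]
    exact (toHolder a ha1 ha2).hasFDerivAt.comp_hasDerivAt 0 h1
  · obtain ⟨⟨⟨-, hcε⟩, hs⟩, hN⟩ := hall' ε hε
    refine ⟨hcε, ?_⟩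
    have hfun : (toHolder a ha1 ha2 (ε • w ε) : ℝ → ℝ) = fun x => ev x (ε • w ε) :=
      funext fun x => toHolder_apply ha1 ha2 (hu0 ε) x
    rw [hfun]
    refine isSteadySolution_ev hβ0 hcε hN (hu0 ε) fun k hk => ?_
    have hk := hs k hk
    have e : (ε • w ε) ^ 2 * M (ε • w ε) = ε ^ 2 • (w ε ^ 2 * M (ε • w ε)) := by
      rw [smul_pow, smul_mul_assoc]
    rw [e, map_smul, map_smul, smul_eq_mul, smul_eq_mul]
    calc (c ε + β * k ^ 2 - 1 / k ^ 2) * (ε * coord k (w ε))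
        = ε * ((symb β k + coord 1 (v ε) / weight 1) * coord k (w ε)) := by
          simp only [hcdef, symb]; ring
      _ = ε ^ 2 * coord k (w ε ^ 2 * M (ε • w ε)) := by rw [hk]; ring
  · have hz : ε • w ε = 0 := ev_injective fun x => by
      refine (toHolder_apply ha1 ha2 (hu0 ε) x).symm.trans
        ((congrArg (fun f : HolderZeroEven a => f x) h).trans ?_)
      rw [map_zero]
      rfl
    have hk := congrArg (coord 1) hz
    rw [map_smul, hw1, smul_eq_mul, map_zero] at hk
    exact mul_ne_zero hne (weight_pos 1).ne' hk
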